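/- Let $\mathcal H$ be a complex Hilbert space and let $K$ be a bounded linear operator on $\mathcal H$ with bounded everywhere defined inverse. A densely defined operator $T$ in $\mathcal H$ is called $K$-invariant if $K^*TK=T$, that is, if $\mathcal D(T)=\mathcal D(K^*TK)=\{f\in\mathcal H : Kf\in\mathcal D(T)\}$ and $K^*TKf=Tf$ for all $f\in\mathcal D(T)$. For nonnegative self-adjoint operators $A_1,A_2$ write $A_1\le A_2$ if $\mathcal D(A_1^{1/2})\supseteq\mathcal D(A_2^{1/2})$ and $\|A_1^{1/2}f\|\le\|A_2^{1/2}f\|$ for all $f\in\mathcal D(A_2^{1/2})$. Let $S$ be a densely defined, symmetric, nonnegative operator in $\mathcal H$ (i.e. $\langle f,Sf\rangle\ge 0$ for all $f\in\mathcal D(S)$) which is $K$-invariant. Then $S$ has a unique largest nonnegative self-adjoint extension $S_F$ (the Friedrichs extension) and a unique smallest nonnegative self-adjoint extension $S_K$ (the Krein--von Neumann extension), so that $S_K\le\hat S\le S_F$ for every nonnegative self-adjoint extension $\hat S$ of $S$, and both $S_F$ and $S_K$ are $K$-invariant. -/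

import Mathlib

noncomputable section

namespace KInv

variable {H : Type*} [NormedAddCommGroup H] [InnerProductSpace ℂ H]

/-- `T` is symmetric: densely defined with `⟪T f, g⟫ = ⟪f, T g⟫` for all `f, g` in its domain. -/
def IsSymmetricOp (T : H →ₗ.[ℂ] H) : Prop :=
  Dense (T.domain : Set H) ∧ T.IsFormalAdjoint T

/-- `T ≥ 0`, that is `⟪f, T f⟫ ≥ 0` on the domain of `T`. It is only used for symmetric operators,
whose quadratic form is automatically real-valued. -/
def IsNonnegOp (T : H →ₗ.[ℂ] H) : Prop :=
  ∀ f : T.domain, 0 ≤ (inner ℂ (f : H) (T f)).re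

variable [CompleteSpace H]

/-- The operator `K* T K` with its natural domain `{f | K f ∈ D(T)}`. -/
def conjOp (K : H →L[ℂ] H) (T : H →ₗ.[ℂ] H) : H →ₗ.[ℂ] H where
  domain := T.domain.comap K.toLinearMap
  toFun := (ContinuousLinearMap.adjoint K).toLinearMap ∘ₗ T.toFun ∘ₗ
    K.toLinearMap.restrict (p := T.domain.comap K.toLinearMap) (q := T.domain) (fun _ hf => hf)

/-- `T` is `K`-invariant: `K* T K = T`, as an equality of operators including their domains. -/
def IsKInvariant (K : H →L[ℂ] H) (T : H →ₗ.[ℂ] H) : Prop :=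
  conjOp K T = T

/-- `T` is a nonnegative self-adjoint operator. -/
def IsNonnegSelfAdjoint (T : H →ₗ.[ℂ] H) : Prop :=
  IsSelfAdjoint T ∧ IsNonnegOp T

/-- `R = A^{1/2}`: the operator `R` is nonnegative and self-adjoint and `R R = A`, where `R R` has
its natural domain `{f ∈ D(R) | R f ∈ D(R)}`. -/
def IsSqrtOp (R A : H →ₗ.[ℂ] H) : Prop :=
  IsNonnegSelfAdjoint R ∧
    ∀ f g : H, (f, g) ∈ A.graph ↔ ∃ h : H, (f, h) ∈ R.graph ∧ (h, g) ∈ R.graph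

/-- The order `A₁ ≤ A₂` of nonnegative self-adjoint operators: `D(A₁^{1/2}) ⊇ D(A₂^{1/2})` and
`‖A₁^{1/2} f‖ ≤ ‖A₂^{1/2} f‖` for all `f ∈ D(A₂^{1/2})`. -/
def OpLE (A₁ A₂ : H →ₗ.[ℂ] H) : Prop :=
  ∃ R₁ R₂ : H →ₗ.[ℂ] H, IsSqrtOp R₁ A₁ ∧ IsSqrtOp R₂ A₂ ∧
    ∃ hdom : R₂.domain ≤ R₁.domain,
      ∀ f : R₂.domain, ‖R₁ (Submodule.inclusion hdom f)‖ ≤ ‖R₂ f‖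

/-- `A` is a nonnegative self-adjoint extension of `S`. -/
def IsNonnegSelfAdjointExtension (S A : H →ₗ.[ℂ] H) : Prop :=
  S ≤ A ∧ IsNonnegSelfAdjoint A

/-- `A` is the Friedrichs extension of `S`: the largest nonnegative self-adjoint extension. -/
def IsFriedrichsExtension (S A : H →ₗ.[ℂ] H) : Prop :=
  IsNonnegSelfAdjointExtension S A ∧
    ∀ B : H →ₗ.[ℂ] H, IsNonnegSelfAdjointExtension S B → OpLE B A

/-- `A` is the Krein–von Neumann extension of `S`: the smallest nonnegative self-adjoint
extension. -/
def IsKreinVonNeumannExtension (S A : H →ₗ.[ℂ] H) : Prop :=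
  IsNonnegSelfAdjointExtension S A ∧
    ∀ B : H →ₗ.[ℂ] H, IsNonnegSelfAdjointExtension S B → OpLE A B

end KInv

end

/-!
Everything is carried over to bounded operators by the resolvent at `-1`. A nonnegative self-adjoint
operator `A` corresponds to the injective operator `B = (1 + A)⁻¹` with `0 ≤ B ≤ 1`, its graph being
`{(B x, x - B x)}` (`IsNonnegSelfAdjoint.exists_isResolvent`, `exists_isResolvent_of_injective`),
and `A₁ ≤ A₂` holds if and only if `B₂ ≤ B₁`. In one direction this is the variational principle
`⟪B x, x⟫ = max_f (2 Re ⟪f, x⟫ - ‖f‖² - ‖A^{1/2} f‖²)` (`OpLE.resolvent_conjOp_le`), which works for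
every square root of `A` in the sense of `IsSqrtOp`. In the other it is Douglas' lemma, applied to
the square root `A^{1/2} = (1 - B)^{1/2} B^{-1/2}` (`IsResolvent.opLE`). In particular the order is
antisymmetric, and largest and smallest extensions are unique.

`A` extends `S` if and only if `B` extends the operator `(1 + S)⁻¹ : f + S f ↦ f`, which is defined
on the range of `1 + S`. Such a partially defined positive contraction has a smallest positive
extension, and this is again a contraction (`exists_least_positive_extension`); it is the resolvent
of the largest extension `S_F`. The same lemma applied to `f + S f ↦ S f`, a restriction of `1 - B`
for every admissible `B`, gives the largest admissible `B` and with it the smallest extension `S_K`.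

Conjugation `A ↦ K* A K` maps the nonnegative self-adjoint extensions of a `K`-invariant `S` to
themselves, with inverse given by `K⁻¹`, and it preserves the order, because the variational
principle holds with `A^{1/2} K` in place of `A^{1/2}`. Hence it fixes the largest and the smallest
extension.
-/

namespace KInv

open ContinuousLinearMap

variable {H : Type*} [NormedAddCommGroup H] [InnerProductSpace ℂ H]

/-! ### Operators through their graphs -/

theorem isNonnegOp_iff_graph {A : H →ₗ.[ℂ] H} :
    IsNonnegOp A ↔ ∀ f g : H, (f, g) ∈ A.graph → 0 ≤ (inner ℂ f g).re := by
  constructor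
  · intro h f g hfg
    obtain ⟨y, rfl, rfl⟩ := (LinearPMap.mem_graph_iff A).1 hfg
    exact h y
  · exact fun h f => h _ _ (A.mem_graph f)

theorem mem_graph_conjOp [CompleteSpace H] {K : H →L[ℂ] H} {T : H →ₗ.[ℂ] H} {f g : H} :
    (f, g) ∈ (conjOp K T).graph ↔ ∃ h, (K f, h) ∈ T.graph ∧ adjoint K h = g := by
  constructor
  · intro hfg
    obtain ⟨y, rfl, rfl⟩ := (LinearPMap.mem_graph_iff _).1 hfg
    exact ⟨T ⟨K y, y.2⟩, T.mem_graph ⟨K y, y.2⟩, rfl⟩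
  · rintro ⟨h, hh, rfl⟩
    obtain ⟨y, hy, rfl⟩ := (LinearPMap.mem_graph_iff _).1 hh
    have hf : f ∈ (conjOp K T).domain := by
      change K f ∈ T.domain
      exact (show (y : H) = K f from hy) ▸ y.2
    refine (LinearPMap.mem_graph_iff _).2 ⟨⟨f, hf⟩, rfl, ?_⟩
    change adjoint K (T ⟨K f, hf⟩) = adjoint K (T y)
    congr 2
    exact Subtype.ext hy.symm

theorem graph_ext {A B : H →ₗ.[ℂ] H} (h : ∀ f g : H, (f, g) ∈ A.graph ↔ (f, g) ∈ B.graph) :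
    A = B :=
  LinearPMap.eq_of_eq_graph (Submodule.ext fun x => h x.1 x.2)

theorem conjOp_one [CompleteSpace H] (T : H →ₗ.[ℂ] H) : conjOp 1 T = T :=
  graph_ext fun f g => by
    have h1 : adjoint (1 : H →L[ℂ] H) = 1 := star_one _
    rw [mem_graph_conjOp, h1]
    simp [-LinearPMap.mem_graph_iff]

theorem conjOp_conjOp [CompleteSpace H] (K L : H →L[ℂ] H) (T : H →ₗ.[ℂ] H) :
    conjOp L (conjOp K T) = conjOp (K * L) T :=
  graph_ext fun f g => by
    simp only [mem_graph_conjOp, ContinuousLinearMap.mul_def, adjoint_comp,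
      ContinuousLinearMap.comp_apply]
    constructor
    · rintro ⟨_, ⟨h, hh, rfl⟩, rfl⟩
      exact ⟨h, hh, rfl⟩
    · rintro ⟨h, hh, rfl⟩
      exact ⟨_, ⟨h, hh, rfl⟩, rfl⟩

theorem conjOp_mono [CompleteSpace H] (K : H →L[ℂ] H) {S T : H →ₗ.[ℂ] H} (h : S ≤ T) :
    conjOp K S ≤ conjOp K T := by
  refine LinearPMap.le_of_le_graph fun ⟨f, g⟩ hfg => ?_
  obtain ⟨h', hh, rfl⟩ := mem_graph_conjOp.1 hfg
  exact mem_graph_conjOp.2 ⟨h', LinearPMap.le_graph_of_le h hh, rfl⟩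

/-- A densely defined `A` is self-adjoint when its graph consists of exactly those pairs that pair
symmetrically with all of its elements. -/
theorem isSelfAdjoint_iff_graph [CompleteSpace H] {A : H →ₗ.[ℂ] H}
    (hd : Dense (A.domain : Set H)) :
    IsSelfAdjoint A ↔ ∀ u v : H, (u, v) ∈ A.graph ↔
      ∀ f g, (f, g) ∈ A.graph → inner ℂ g u = inner ℂ f v := by
  have key : ∀ u v : H, (u, v) ∈ A.adjoint.graph ↔
      ∀ f g, (f, g) ∈ A.graph → inner ℂ g u = inner ℂ f v := fun u v => by
    rw [LinearPMap.adjoint_graph_eq_graph_adjoint hd, Submodule.mem_adjoint_iff]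
    simp only [sub_eq_zero]
  rw [LinearPMap.isSelfAdjoint_def]
  constructor
  · intro h u v
    rw [← key, h]
  · intro h
    exact graph_ext fun u v => by rw [key, h]

theorem norm_sq_add_norm_sq_le_of_inner_nonneg {f g : H} (h : 0 ≤ (inner ℂ f g).re) :
    ‖f‖ ^ 2 + ‖g‖ ^ 2 ≤ ‖f + g‖ ^ 2 := by
  have := norm_add_sq (𝕜 := ℂ) f g
  simp only [RCLike.re_to_complex] at this
  linarith

/-! ### Resolvents -/

/-- `B = (1 + A)⁻¹` with `0 ≤ B ≤ 1`: the graph of `A` consists of the pairs `(B x, x - B x)`.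
Injectivity of `B` is not a field, since it follows from the graph being single-valued. -/
structure IsResolvent (B : H →L[ℂ] H) (A : H →ₗ.[ℂ] H) : Prop where
  isPositive : B.IsPositive
  one_sub_isPositive : (1 - B).IsPositive
  mem_graph_iff : ∀ f g : H, (f, g) ∈ A.graph ↔ B (f + g) = f

theorem IsResolvent.mem_graph {B : H →L[ℂ] H} {A : H →ₗ.[ℂ] H} (h : IsResolvent B A) (x : H) :
    (B x, x - B x) ∈ A.graph :=
  (h.mem_graph_iff _ _).2 (by rw [add_sub_cancel])

theorem IsResolvent.unique {B : H →L[ℂ] H} {A A' : H →ₗ.[ℂ] H} (h : IsResolvent B A)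
    (h' : IsResolvent B A') : A = A' :=
  graph_ext fun f g => by rw [h.mem_graph_iff, h'.mem_graph_iff]

theorem IsResolvent.le_iff {B : H →L[ℂ] H} {A S : H →ₗ.[ℂ] H} (h : IsResolvent B A) :
    S ≤ A ↔ ∀ f : S.domain, B (f + S f) = f := by
  rw [← LinearPMap.le_graph_iff]
  constructor
  · exact fun hS f => (h.mem_graph_iff _ _).1 (hS (S.mem_graph f))
  · rintro hS ⟨f, g⟩ hfg
    obtain ⟨y, rfl, rfl⟩ := (LinearPMap.mem_graph_iff S).1 hfg
    exact (h.mem_graph_iff _ _).2 (hS y)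

variable [CompleteSpace H]

/-! ### Graphs of self-adjoint operators -/

theorem _root_.IsSelfAdjoint.mem_graph_iff {A : H →ₗ.[ℂ] H} (hA : IsSelfAdjoint A) {u v : H} :
    (u, v) ∈ A.graph ↔ ∀ f g, (f, g) ∈ A.graph → inner ℂ g u = inner ℂ f v :=
  (isSelfAdjoint_iff_graph hA.dense_domain).1 hA u v

theorem _root_.IsSelfAdjoint.inner_graph {A : H →ₗ.[ℂ] H} (hA : IsSelfAdjoint A) {f g u v : H}
    (hf : (f, g) ∈ A.graph) (hu : (u, v) ∈ A.graph) : inner ℂ g u = inner ℂ f v :=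
  hA.mem_graph_iff.1 hu f g hf

/-- Conjugation by an invertible operator preserves nonnegative self-adjointness. -/
theorem IsNonnegSelfAdjoint.conjOp {A : H →ₗ.[ℂ] H} (hA : IsNonnegSelfAdjoint A)
    {K : H →L[ℂ] H} (hK : IsUnit K) : IsNonnegSelfAdjoint (conjOp K A) := by
  obtain ⟨L, hKL, hLK⟩ := isUnit_iff_exists.1 hK
  have hKL' : ∀ x, K (L x) = x := fun x => congrArg (fun T : H →L[ℂ] H => T x) hKL
  have hLK' : ∀ x, L (K x) = x := fun x => congrArg (fun T : H →L[ℂ] H => T x) hLK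
  have hdense : Dense ((KInv.conjOp K A).domain : Set H) := by
    have himg : L '' (A.domain : Set H) ⊆ (KInv.conjOp K A).domain := by
      rintro _ ⟨x, hx, rfl⟩
      change K (L x) ∈ A.domain
      rwa [hKL']
    have hsurj : Function.Surjective L := fun x => ⟨K x, hLK' x⟩
    exact (hsurj.denseRange.dense_image L.continuous hA.1.dense_domain).mono himg
  refine ⟨(isSelfAdjoint_iff_graph hdense).2 fun u v => ?_,
    isNonnegOp_iff_graph.2 fun f g hfg => ?_⟩
  · constructor
    · rintro huv f g hfg
      obtain ⟨h, hh, rfl⟩ := mem_graph_conjOp.1 huv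
      obtain ⟨h', hh', rfl⟩ := mem_graph_conjOp.1 hfg
      rw [adjoint_inner_left, adjoint_inner_right, hA.1.inner_graph hh' hh]
    · intro huv
      refine mem_graph_conjOp.2 ⟨adjoint L v, hA.1.mem_graph_iff.2 fun f g hfg => ?_, ?_⟩
      · have := huv (L f) (adjoint K g) (mem_graph_conjOp.2 ⟨g, by rwa [hKL'], rfl⟩)
        rwa [adjoint_inner_left, ← adjoint_inner_right L] at this
      · refine ext_inner_left ℂ fun x => ?_
        rw [adjoint_inner_right, adjoint_inner_right, hLK']
  · obtain ⟨h, hh, rfl⟩ := mem_graph_conjOp.1 hfg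
    rw [adjoint_inner_right]
    exact isNonnegOp_iff_graph.1 hA.2 _ _ hh

/-! ### The resolvent of a nonnegative self-adjoint operator -/

/-- For `A ≥ 0` self-adjoint, `1 + A` maps onto the whole space: its range is closed because
`‖f‖² + ‖A f‖² ≤ ‖f + A f‖²` and the graph is closed, and a vector `y` orthogonal to the range
satisfies `A y = -y`, hence vanishes. -/
theorem IsNonnegSelfAdjoint.exists_isResolvent {A : H →ₗ.[ℂ] H} (hA : IsNonnegSelfAdjoint A) :
    ∃ B : H →L[ℂ] H, IsResolvent B A := by
  have hpos := isNonnegOp_iff_graph.1 hA.2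
  have hclosed : IsClosed (A.graph : Set (H × H)) := hA.1.isClosed
  have : CompleteSpace A.graph := hclosed.completeSpace_coe
  let Φ : A.graph →L[ℂ] H :=
    (ContinuousLinearMap.fst ℂ H H + ContinuousLinearMap.snd ℂ H H) ∘L A.graph.subtypeL
  have hΦ : ∀ x : A.graph, Φ x = (x : H × H).1 + (x : H × H).2 := fun x => rfl
  have hanti : AntilipschitzWith 1 Φ := by
    refine AddMonoidHomClass.antilipschitz_of_bound Φ fun x => ?_
    have h1 := norm_sq_add_norm_sq_le_of_inner_nonneg (hpos _ _ x.2)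
    rw [hΦ, NNReal.coe_one, one_mul, Submodule.coe_norm, Prod.norm_def]
    refine max_le ?_ ?_ <;> refine abs_le_of_sq_le_sq' ?_ (norm_nonneg _) |>.2 <;> nlinarith
  have hcl : IsClosed (Set.range Φ) := hanti.isClosed_range Φ.uniformContinuous
  have hrange : Φ.range = ⊤ := by
    have : CompleteSpace Φ.range := IsClosed.completeSpace_coe (hs := hcl)
    rw [← Submodule.orthogonal_eq_bot_iff, Submodule.eq_bot_iff]
    intro y hy
    have hyA : (y, -y) ∈ A.graph := hA.1.mem_graph_iff.2 fun f g hfg => by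
      have : inner ℂ (f + g) y = 0 := hy (f + g) ⟨⟨(f, g), hfg⟩, rfl⟩
      rw [inner_add_left] at this
      rw [inner_neg_right]
      linear_combination this
    have := norm_sq_add_norm_sq_le_of_inner_nonneg (hpos _ _ hyA)
    rw [add_neg_cancel, norm_zero, norm_neg] at this
    have : ‖y‖ = 0 := by nlinarith [norm_nonneg y]
    exact norm_eq_zero.1 this
  let e := ContinuousLinearEquiv.ofBijective Φ (LinearMap.ker_eq_bot.2 hanti.injective) hrange
  let B : H →L[ℂ] H := ContinuousLinearMap.fst ℂ H H ∘L A.graph.subtypeL ∘L e.symm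
  have hB : ∀ f g, (f, g) ∈ A.graph → B (f + g) = f := fun f g hfg => by
    have : e.symm (f + g) = ⟨(f, g), hfg⟩ := by
      rw [ContinuousLinearEquiv.symm_apply_eq]
      rfl
    change (e.symm (f + g) : H × H).1 = f
    rw [this]
  have hsurj : ∀ x : H, ∃ f g, (f, g) ∈ A.graph ∧ f + g = x := fun x => by
    refine ⟨_, _, (e.symm x).2, ?_⟩
    rw [← hΦ]
    exact e.apply_symm_apply x
  have hsymm : B.IsSymmetric := fun x y => by
    obtain ⟨f, g, hfg, rfl⟩ := hsurj x
    obtain ⟨u, v, huv, rfl⟩ := hsurj y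
    change inner ℂ (B _) _ = inner ℂ _ (B _)
    rw [hB _ _ hfg, hB _ _ huv, inner_add_left, inner_add_right, hA.1.inner_graph hfg huv]
  refine ⟨B, ⟨hsymm, fun x => ?_⟩, ⟨LinearMap.IsSymmetric.id.sub hsymm, fun x => ?_⟩,
    fun f g => ⟨hB f g, fun h => ?_⟩⟩
  · obtain ⟨f, g, hfg, rfl⟩ := hsurj x
    rw [reApplyInnerSelf_apply, hB _ _ hfg, inner_add_right, map_add]
    exact add_nonneg inner_self_nonneg (hpos _ _ hfg)
  · obtain ⟨f, g, hfg, rfl⟩ := hsurj x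
    rw [reApplyInnerSelf_apply, sub_apply, one_apply_eq_self, hB _ _ hfg, add_sub_cancel_left,
      inner_add_right, map_add, inner_re_symm]
    exact add_nonneg (hpos _ _ hfg) inner_self_nonneg
  · obtain ⟨u, v, huv, hx⟩ := hsurj (f + g)
    have hu : u = f := by rw [← h, ← hx, hB _ _ huv]
    subst hu
    rwa [add_right_inj u |>.1 hx] at huv

/-! ### Square roots of bounded positive operators -/

theorem _root_.ContinuousLinearMap.IsPositive.sqrt_sqrt_apply {B : H →L[ℂ] H} (hB : B.IsPositive)
    (x : H) : CFC.sqrt B (CFC.sqrt B x) = B x := by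
  have := CFC.sqrt_mul_sqrt_self B ((nonneg_iff_isPositive B).2 hB)
  exact congrArg (fun T : H →L[ℂ] H => T x) this

theorem _root_.ContinuousLinearMap.isPositive_sqrt (B : H →L[ℂ] H) : (CFC.sqrt B).IsPositive :=
  (nonneg_iff_isPositive _).1 (CFC.sqrt_nonneg B)

theorem sqrt_comm_sqrt_one_sub (B : H →L[ℂ] H) :
    Commute (CFC.sqrt B) (CFC.sqrt (1 - B)) := by
  have h : Commute B (1 - B) := (Commute.one_right B).sub_right (Commute.refl B)
  exact ((h.cfcₙ_nnreal _).symm.cfcₙ_nnreal _).symm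

theorem norm_sqrt_apply_sq {B : H →L[ℂ] H} (hB : B.IsPositive) (x : H) :
    ‖CFC.sqrt B x‖ ^ 2 = (inner ℂ (B x) x).re := by
  have hs : ∀ x y, inner ℂ (CFC.sqrt B x) y = inner ℂ x (CFC.sqrt B y) :=
    (isPositive_sqrt B).isSymmetric
  rw [← hB.sqrt_sqrt_apply, hs, inner_self_eq_norm_sq_to_K]
  norm_cast

theorem norm_sqrt_one_sub_apply_sq {B : H →L[ℂ] H} (hB : B.IsPositive)
    (hB1 : (1 - B).IsPositive) (x : H) :
    ‖CFC.sqrt (1 - B) x‖ ^ 2 = ‖x‖ ^ 2 - ‖CFC.sqrt B x‖ ^ 2 := by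
  rw [norm_sqrt_apply_sq hB, norm_sqrt_apply_sq hB1, sub_apply, inner_sub_left,
    one_apply_eq_self, Complex.sub_re, inner_self_eq_norm_sq_to_K]
  norm_cast

theorem norm_apply_sq_le_inner {B : H →L[ℂ] H} (hB : B.IsPositive) (hB1 : (1 - B).IsPositive)
    (x : H) : ‖B x‖ ^ 2 ≤ (inner ℂ (B x) x).re := by
  have := norm_sqrt_one_sub_apply_sq hB hB1 (CFC.sqrt B x)
  rw [hB.sqrt_sqrt_apply, norm_sqrt_apply_sq hB] at this
  nlinarith [sq_nonneg ‖CFC.sqrt (1 - B) (CFC.sqrt B x)‖]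

/-! ### Operators given by commuting pairs -/

theorem _root_.ContinuousLinearMap.denseRange_of_isSelfAdjoint_of_injective {C : H →L[ℂ] H}
    (hC : IsSelfAdjoint C) (hinj : Function.Injective C) : DenseRange C := by
  have h : (C.range)ᗮ = ⊥ := by
    rw [orthogonal_range, hC.adjoint_eq]
    exact LinearMap.ker_eq_bot.2 hinj
  have h2 := (Submodule.topologicalClosure_eq_top_iff (K := C.range)).2 h
  exact Submodule.dense_iff_topologicalClosure_eq_top.2 h2

/-- For commuting self-adjoint `C`, `D` with `C` injective and `C D ≥ 0`, the pairs `(C x, D x)`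
form the graph of the nonnegative symmetric operator `D C⁻¹`. An identity `P C + Q D = 1` makes it
self-adjoint: a pair `(u, v)` in the graph of the adjoint satisfies `D u = C v`, and then
`x = P u + Q v` gives `C x = u` and `D x = v`. -/
theorem exists_isNonnegSelfAdjoint_of_pair {C D P Q : H →L[ℂ] H} (hC : IsSelfAdjoint C)
    (hD : IsSelfAdjoint D) (hinj : Function.Injective C) (hCD : ∀ x, C (D x) = D (C x))
    (hCP : ∀ x, C (P x) = P (C x)) (hCQ : ∀ x, C (Q x) = Q (C x))
    (hDP : ∀ x, D (P x) = P (D x)) (hDQ : ∀ x, D (Q x) = Q (D x))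
    (hPQ : ∀ x, P (C x) + Q (D x) = x) (hpos : ∀ x, 0 ≤ (inner ℂ (C x) (D x)).re) :
    ∃ A : H →ₗ.[ℂ] H, IsNonnegSelfAdjoint A ∧
      ∀ f g, (f, g) ∈ A.graph ↔ ∃ x, C x = f ∧ D x = g := by
  let G : Submodule ℂ (H × H) := LinearMap.range ((C : H →ₗ[ℂ] H).prod (D : H →ₗ[ℂ] H))
  have hG : ∀ f g, (f, g) ∈ G ↔ ∃ x, C x = f ∧ D x = g := fun f g => by
    simp [G, LinearMap.mem_range, Prod.ext_iff]
  have hgraph : G.toLinearPMap.graph = G :=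
    Submodule.toLinearPMap_graph_eq G fun ⟨f, g⟩ hfg hf => by
      obtain ⟨x, hx, rfl⟩ := (hG f g).1 hfg
      have : x = 0 := hinj (by rw [hx, map_zero]; exact hf)
      rw [this, map_zero]
  have hmem : ∀ f g, (f, g) ∈ G.toLinearPMap.graph ↔ ∃ x, C x = f ∧ D x = g := fun f g => by
    rw [hgraph, hG]
  have hsC : ∀ x y, inner ℂ (C x) y = inner ℂ x (C y) := hC.isSymmetric
  have hsD : ∀ x y, inner ℂ (D x) y = inner ℂ x (D y) := hD.isSymmetric
  have hdense : Dense (G.toLinearPMap.domain : Set H) :=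
    (denseRange_of_isSelfAdjoint_of_injective hC hinj).mono <| by
      rintro _ ⟨x, rfl⟩
      exact LinearPMap.mem_domain_of_mem_graph ((hmem _ _).2 ⟨x, rfl, rfl⟩)
  refine ⟨G.toLinearPMap, ⟨(isSelfAdjoint_iff_graph hdense).2 fun u v => ?_,
    isNonnegOp_iff_graph.2 fun f g hfg => ?_⟩, hmem⟩
  · constructor
    · rintro huv f g hfg
      obtain ⟨x, rfl, rfl⟩ := (hmem _ _).1 huv
      obtain ⟨y, rfl, rfl⟩ := (hmem _ _).1 hfg
      rw [hsD, hsC, hCD]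
    · intro h
      have huv : D u = C v := ext_inner_left ℂ fun x => by
        rw [← hsD, ← hsC]
        exact h _ _ ((hmem _ _).2 ⟨x, rfl, rfl⟩)
      refine (hmem _ _).2 ⟨P u + Q v, ?_, ?_⟩
      · rw [map_add, hCP, hCQ, ← huv, hPQ]
      · rw [map_add, hDP, hDQ, huv, hPQ]
  · obtain ⟨x, rfl, rfl⟩ := (hmem _ _).1 hfg
    exact hpos x

/-- Every injective `B` with `0 ≤ B ≤ 1` is the resolvent of a nonnegative self-adjoint operator. -/
theorem exists_isResolvent_of_injective {B : H →L[ℂ] H} (hB : B.IsPositive)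
    (hB1 : (1 - B).IsPositive) (hinj : Function.Injective B) :
    ∃ A : H →ₗ.[ℂ] H, IsNonnegSelfAdjoint A ∧ IsResolvent B A := by
  obtain ⟨A, hA, hgraph⟩ := exists_isNonnegSelfAdjoint_of_pair (C := B) (D := 1 - B) (P := 1)
    (Q := 1) hB.isSelfAdjoint hB1.isSelfAdjoint hinj (by simp) (by simp) (by simp) (by simp)
    (by simp) (by simp) fun x => by
      have := norm_apply_sq_le_inner hB hB1 x
      have h2 : (inner ℂ (B x) (B x)).re = ‖B x‖ ^ 2 := by
        rw [inner_self_eq_norm_sq_to_K]; norm_cast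
      rw [sub_apply, inner_sub_right, Complex.sub_re, one_apply_eq_self, h2]
      linarith
  refine ⟨A, hA, hB, hB1, fun f g => ?_⟩
  rw [hgraph]
  constructor
  · rintro ⟨x, rfl, rfl⟩
    simp
  · exact fun h => ⟨f + g, h, by rw [sub_apply, one_apply_eq_self, h, add_sub_cancel_left]⟩

/-! ### Square roots and the order of operators -/

theorem IsResolvent.injective_sqrt {B : H →L[ℂ] H} {A : H →ₗ.[ℂ] H} (h : IsResolvent B A) :
    Function.Injective ⇑(CFC.sqrt B) := by
  rw [injective_iff_map_eq_zero]
  intro x hx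
  have hB0 : B x = 0 := by rw [← h.isPositive.sqrt_sqrt_apply, hx, map_zero]
  have := h.mem_graph x
  rw [hB0, sub_zero] at this
  exact A.graph_fst_eq_zero_snd this rfl

/-- The square root of the operator with resolvent `B` is `(1 - B)^{1/2} B^{-1/2}`. -/
theorem IsResolvent.exists_isSqrtOp {B : H →L[ℂ] H} {A : H →ₗ.[ℂ] H} (h : IsResolvent B A) :
    ∃ R, IsSqrtOp R A ∧
      ∀ f g, (f, g) ∈ R.graph ↔ ∃ x, CFC.sqrt B x = f ∧ CFC.sqrt (1 - B) x = g := by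
  set C := CFC.sqrt B with hCdef
  set D := CFC.sqrt (1 - B) with hDdef
  have hCC : ∀ x, C (C x) = B x := h.isPositive.sqrt_sqrt_apply
  have hDD : ∀ x, D (D x) = x - B x := h.one_sub_isPositive.sqrt_sqrt_apply
  have hCD : ∀ x, C (D x) = D (C x) := fun x =>
    congrArg (fun T : H →L[ℂ] H => T x) (sqrt_comm_sqrt_one_sub B).eq
  have hsum : ∀ x, C (C x) + D (D x) = x := fun x => by rw [hCC, hDD, add_sub_cancel]
  have hpos : ∀ x, 0 ≤ (inner ℂ (C x) (D x)).re := fun x => by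
    have h0 : 0 ≤ C * D := (sqrt_comm_sqrt_one_sub B).mul_nonneg (CFC.sqrt_nonneg _)
      (CFC.sqrt_nonneg _)
    have h1 := ((nonneg_iff_isPositive _).1 h0).re_inner_nonneg_right x
    have hsC : ∀ x y, inner ℂ (C x) y = inner ℂ x (C y) := (isPositive_sqrt B).isSymmetric
    rw [hsC]
    exact h1
  obtain ⟨R, hR, hgraph⟩ := exists_isNonnegSelfAdjoint_of_pair (C := C) (D := D) (P := C) (Q := D)
    (isPositive_sqrt B).isSelfAdjoint (isPositive_sqrt _).isSelfAdjoint h.injective_sqrt hCD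
    (fun _ => rfl) hCD (fun x => (hCD x).symm) (fun _ => rfl) hsum hpos
  refine ⟨R, ⟨hR, fun f g => ?_⟩, hgraph⟩
  simp only [hgraph, h.mem_graph_iff]
  constructor
  · intro hfg
    refine ⟨C (D (f + g)), ⟨C (f + g), by rw [hCC, hfg], (hCD _).symm⟩, D (f + g), rfl, ?_⟩
    rw [hDD, hfg, add_sub_cancel_left]
  · rintro ⟨_, ⟨x, rfl, rfl⟩, y, hxy, rfl⟩
    -- with `z = C x + D y` one has `x = C z` and `y = D z`
    have hx : C (C x + D y) = x := by rw [map_add, hCD, hxy, hsum]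
    rw [← hCC, hx]

/-- **Douglas' lemma** for an injective self-adjoint operator `C`. -/
theorem exists_apply_eq_of_norm_le {C C' : H →L[ℂ] H} (hC : IsSelfAdjoint C)
    (hinj : Function.Injective C) (hC' : IsSelfAdjoint C') (hle : ∀ x, ‖C' x‖ ≤ ‖C x‖) (x : H) :
    ∃ y, C y = C' x ∧ ‖y‖ ≤ ‖x‖ := by
  have hd : DenseRange (C : H →ₗ[ℂ] H) := denseRange_of_isSelfAdjoint_of_injective hC hinj
  have hb : ∀ x, ‖(C' : H →ₗ[ℂ] H) x‖ ≤ 1 * ‖(C : H →ₗ[ℂ] H) x‖ := by simpa using hle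
  -- `V` is the contraction with `V C = C'`, so that `C V* = C'`
  let V : H →L[ℂ] H := (C' : H →ₗ[ℂ] H).extendOfNorm (C : H →ₗ[ℂ] H)
  have hV : ∀ x, V (C x) = C' x := LinearMap.extendOfNorm_eq hd ⟨1, hb⟩
  have hV1 : ‖V‖ ≤ 1 := LinearMap.opNorm_extendOfNorm_le hd zero_le_one hb
  refine ⟨adjoint V x, ext_inner_left ℂ fun z => ?_, ?_⟩
  · have hsC : ∀ x y, inner ℂ (C x) y = inner ℂ x (C y) := hC.isSymmetric
    have hsC' : ∀ x y, inner ℂ (C' x) y = inner ℂ x (C' y) := hC'.isSymmetric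
    rw [← hsC, adjoint_inner_right, hV, hsC']
  · refine ((adjoint V).le_opNorm x).trans ?_
    rw [LinearIsometryEquiv.norm_map]
    exact mul_le_of_le_one_left (norm_nonneg x) hV1

/-- Passing to resolvents reverses the order: from `B₂ ≤ B₁` to `A₁ ≤ A₂`. -/
theorem IsResolvent.opLE {B₁ B₂ : H →L[ℂ] H} {A₁ A₂ : H →ₗ.[ℂ] H} (h₁ : IsResolvent B₁ A₁)
    (h₂ : IsResolvent B₂ A₂) (hle : B₂ ≤ B₁) : OpLE A₁ A₂ := by
  obtain ⟨R₁, hR₁, hg₁⟩ := h₁.exists_isSqrtOp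
  obtain ⟨R₂, hR₂, hg₂⟩ := h₂.exists_isSqrtOp
  have hC : ∀ x, ‖CFC.sqrt B₂ x‖ ≤ ‖CFC.sqrt B₁ x‖ := fun x => by
    rw [← sq_le_sq₀ (norm_nonneg _) (norm_nonneg _), norm_sqrt_apply_sq h₁.isPositive,
      norm_sqrt_apply_sq h₂.isPositive]
    have := ((ContinuousLinearMap.le_def _ _).1 hle).re_inner_nonneg_left x
    rw [sub_apply, inner_sub_left, map_sub] at this
    exact (sub_nonneg (α := ℝ)).1 this
  have key : ∀ f g, (f, g) ∈ R₂.graph → ∃ g', (f, g') ∈ R₁.graph ∧ ‖g'‖ ≤ ‖g‖ := by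
    intro f g hfg
    obtain ⟨x, rfl, rfl⟩ := (hg₂ f g).1 hfg
    obtain ⟨y, hy, hyx⟩ := exists_apply_eq_of_norm_le (isPositive_sqrt B₁).isSelfAdjoint
      h₁.injective_sqrt (isPositive_sqrt B₂).isSelfAdjoint hC x
    refine ⟨CFC.sqrt (1 - B₁) y, (hg₁ _ _).2 ⟨y, hy, rfl⟩, ?_⟩
    rw [← sq_le_sq₀ (norm_nonneg _) (norm_nonneg _),
      norm_sqrt_one_sub_apply_sq h₁.isPositive h₁.one_sub_isPositive,
      norm_sqrt_one_sub_apply_sq h₂.isPositive h₂.one_sub_isPositive, hy]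
    gcongr
  have hdom : R₂.domain ≤ R₁.domain := fun f hf => by
    obtain ⟨g, hg, -⟩ := key _ _ (R₂.mem_graph ⟨f, hf⟩)
    exact LinearPMap.mem_domain_of_mem_graph hg
  refine ⟨R₁, R₂, hR₁, hR₂, hdom, fun f => ?_⟩
  obtain ⟨g, hg, hle⟩ := key _ _ (R₂.mem_graph f)
  rwa [← R₁.mem_graph_snd_inj hg (R₁.mem_graph (Submodule.inclusion hdom f)) rfl]

theorem OpLE.exists_graph {A₁ A₂ : H →ₗ.[ℂ] H} (h : OpLE A₁ A₂) :
    ∃ R₁ R₂ : H →ₗ.[ℂ] H, IsSqrtOp R₁ A₁ ∧ IsSqrtOp R₂ A₂ ∧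
      ∀ f g, (f, g) ∈ R₂.graph → ∃ g', (f, g') ∈ R₁.graph ∧ ‖g'‖ ≤ ‖g‖ := by
  obtain ⟨R₁, R₂, h₁, h₂, hdom, hle⟩ := h
  refine ⟨R₁, R₂, h₁, h₂, fun f g hfg => ?_⟩
  obtain ⟨y, rfl, rfl⟩ := (LinearPMap.mem_graph_iff _).1 hfg
  exact ⟨_, R₁.mem_graph (Submodule.inclusion hdom y), hle y⟩

/-- The form identity `⟪A^{1/2} f, A^{1/2} g⟫ = ⟪f, A g⟫` for `g ∈ D(A)` and `f ∈ D(A^{1/2})`. -/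
theorem IsSqrtOp.exists_inner_eq {R A : H →ₗ.[ℂ] H} (h : IsSqrtOp R A) {g k : H}
    (hgk : (g, k) ∈ A.graph) :
    ∃ s, (g, s) ∈ R.graph ∧ ∀ f r, (f, r) ∈ R.graph → inner ℂ r s = inner ℂ f k := by
  obtain ⟨s, hgs, hsk⟩ := (h.2 g k).1 hgk
  exact ⟨s, hgs, fun f r hfr => h.1.1.inner_graph hfr hsk⟩

/-- The order `A₁ ≤ A₂` gives `(1 + K* A₂ K)⁻¹ ≤ (1 + K* A₁ K)⁻¹` for every bounded `K`. This is the
variational principle: `⟪(1 + K* A K)⁻¹ x, x⟫` is the maximum of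
`2 Re ⟪f, x⟫ - ‖f‖² - ‖A^{1/2} K f‖²`, attained at `f = (1 + K* A K)⁻¹ x`. -/
theorem OpLE.resolvent_conjOp_le {A₁ A₂ : H →ₗ.[ℂ] H} (h : OpLE A₁ A₂) {K B₁ B₂ : H →L[ℂ] H}
    (h₁ : IsResolvent B₁ (conjOp K A₁)) (h₂ : IsResolvent B₂ (conjOp K A₂)) : B₂ ≤ B₁ := by
  rw [ContinuousLinearMap.le_def]
  refine ⟨LinearMap.IsSymmetric.sub h₁.isPositive.isSymmetric h₂.isPositive.isSymmetric,
    fun x => ?_⟩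
  obtain ⟨R₁, R₂, hR₁, hR₂, hle⟩ := h.exists_graph
  obtain ⟨k₁, hk₁, hk₁x⟩ := mem_graph_conjOp.1 (h₁.mem_graph x)
  obtain ⟨k₂, hk₂, hk₂x⟩ := mem_graph_conjOp.1 (h₂.mem_graph x)
  obtain ⟨s₁, hs₁, hi₁⟩ := hR₁.exists_inner_eq hk₁
  obtain ⟨s₂, hs₂, hi₂⟩ := hR₂.exists_inner_eq hk₂
  obtain ⟨r, hr, hrs⟩ := hle _ _ hs₂
  have e₁ := hi₁ _ _ hs₁
  have e₂ := hi₂ _ _ hs₂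
  have e₃ := hi₁ _ _ hr
  rw [← adjoint_inner_right, hk₁x, inner_sub_right] at e₁ e₃
  rw [← adjoint_inner_right, hk₂x, inner_sub_right] at e₂
  have self : ∀ y : H, (inner ℂ y y).re = ‖y‖ ^ 2 := fun y => by
    rw [inner_self_eq_norm_sq_to_K]; norm_cast
  replace e₁ := congrArg Complex.re e₁
  replace e₂ := congrArg Complex.re e₂
  replace e₃ := congrArg Complex.re e₃
  rw [Complex.sub_re, self, self] at e₁ e₂
  rw [Complex.sub_re] at e₃
  have n₁ := norm_sub_sq (𝕜 := ℂ) (B₂ x) (B₁ x)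
  have n₂ := norm_sub_sq (𝕜 := ℂ) r s₁
  simp only [RCLike.re_to_complex] at n₁ n₂
  have hrs' : ‖r‖ ^ 2 ≤ ‖s₂‖ ^ 2 := by gcongr
  rw [reApplyInnerSelf_apply, sub_apply, inner_sub_left, RCLike.re_to_complex, Complex.sub_re]
  nlinarith [sq_nonneg ‖B₂ x - B₁ x‖, sq_nonneg ‖r - s₁‖]

theorem OpLE.resolvent_le {A₁ A₂ : H →ₗ.[ℂ] H} (h : OpLE A₁ A₂) {B₁ B₂ : H →L[ℂ] H}
    (h₁ : IsResolvent B₁ A₁) (h₂ : IsResolvent B₂ A₂) : B₂ ≤ B₁ :=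
  h.resolvent_conjOp_le (K := 1) (by rwa [conjOp_one]) (by rwa [conjOp_one])

theorem OpLE.antisymm {A₁ A₂ : H →ₗ.[ℂ] H} (h : OpLE A₁ A₂) (h' : OpLE A₂ A₁)
    (hA₁ : IsNonnegSelfAdjoint A₁) (hA₂ : IsNonnegSelfAdjoint A₂) : A₁ = A₂ := by
  obtain ⟨B₁, h₁⟩ := hA₁.exists_isResolvent
  obtain ⟨B₂, h₂⟩ := hA₂.exists_isResolvent
  obtain rfl : B₁ = B₂ := le_antisymm (h'.resolvent_le h₂ h₁) (h.resolvent_le h₁ h₂)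
  exact h₁.unique h₂

/-! ### The smallest positive extension of a partially defined contraction -/

/-- A partially defined operator `a v ↦ b v` with `‖b v‖² ≤ ⟪b v, a v⟫` and hermitian form has a
smallest positive extension `B`, and `B ≤ 1`. With `E` the completion of `V` for the form
`⟪b v, a w⟫` and `T : E → H` the contraction induced by `b`, the extension is `B = T T*`: the
adjoint `T*` sends `a v` to the class of `v`. -/
theorem exists_least_positive_extension {V : Type*} [AddCommGroup V] [Module ℂ V]
    (a b : V →ₗ[ℂ] H) (hsymm : ∀ v w, inner ℂ (b v) (a w) = inner ℂ (a v) (b w))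
    (hle : ∀ v, ‖b v‖ ^ 2 ≤ (inner ℂ (b v) (a v)).re) :
    ∃ B : H →L[ℂ] H, B.IsPositive ∧ (1 - B).IsPositive ∧ (∀ v, B (a v) = b v) ∧
      ∀ B' : H →L[ℂ] H, B'.IsPositive → (∀ v, B' (a v) = b v) → B ≤ B' := by
  -- the form may be degenerate on `V`; passing to the completion divides out its kernel
  let core : PreInnerProductSpace.Core ℂ V :=
    { inner := fun v w => inner ℂ (b v) (a w)
      conj_inner_symm := fun v w => by rw [inner_conj_symm, hsymm]
      re_inner_nonneg := fun v => (sq_nonneg _).trans (hle v)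
      add_left := fun u v w => by rw [map_add, inner_add_left]
      smul_left := fun u v r => by rw [map_smul, inner_smul_left] }
  let _ : SeminormedAddCommGroup V := InnerProductSpace.Core.toSeminormedAddCommGroup (c := core)
  let _ : InnerProductSpace ℂ V := InnerProductSpace.ofCore core
  have hinner : ∀ v w : V, inner ℂ v w = inner ℂ (b v) (a w) := fun _ _ => rfl
  have hnorm : ∀ v : V, ‖v‖ ^ 2 = (inner ℂ (b v) (a v)).re := fun v => by
    rw [← hinner, inner_self_eq_norm_sq_to_K]; norm_cast
  let E := UniformSpace.Completion V
  let j : V →ₗ[ℂ] E := (UniformSpace.Completion.toComplₗᵢ (𝕜 := ℂ) (E := V)).toLinearMap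
  have hj : DenseRange j := UniformSpace.Completion.denseRange_coe
  have hjinner : ∀ v w : V, inner ℂ (j v) (j w) = inner ℂ (b v) (a w) := fun v w =>
    UniformSpace.Completion.inner_coe v w
  have hjnorm : ∀ v, ‖j v‖ = ‖v‖ := fun v => UniformSpace.Completion.norm_coe v
  have hb : ∀ v, ‖b v‖ ≤ 1 * ‖j v‖ := fun v => by
    rw [one_mul, hjnorm, ← sq_le_sq₀ (norm_nonneg _) (norm_nonneg _), hnorm]
    exact hle v
  let T : E →L[ℂ] H := b.extendOfNorm j
  have hT : ∀ v, T (j v) = b v := LinearMap.extendOfNorm_eq hj ⟨1, hb⟩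
  have hT1 : ‖T‖ ≤ 1 := LinearMap.opNorm_extendOfNorm_le hj zero_le_one hb
  have hT1' : ∀ x, ‖adjoint T x‖ ≤ ‖x‖ := fun x => by
    refine ((adjoint T).le_opNorm x).trans ?_
    rw [LinearIsometryEquiv.norm_map]
    exact mul_le_of_le_one_left (norm_nonneg x) hT1
  have hTa : ∀ v, adjoint T (a v) = j v := fun v => by
    refine ext_inner_left ℂ fun e => ?_
    induction e using hj.induction_on with
    | hp => exact isClosed_eq (by fun_prop) (by fun_prop)
    | ih w => rw [adjoint_inner_right, hT, hjinner]
  have hform : ∀ x, (inner ℂ (T (adjoint T x)) x).re = ‖adjoint T x‖ ^ 2 := fun x => by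
    rw [← adjoint_inner_right, inner_self_eq_norm_sq_to_K]; norm_cast
  have hB : (T ∘L adjoint T).IsPositive := isPositive_self_comp_adjoint T
  refine ⟨T ∘L adjoint T, hB, ⟨LinearMap.IsSymmetric.id.sub hB.isSymmetric, fun x => ?_⟩,
    fun v => ?_, fun B' hB' hB'a => ⟨LinearMap.IsSymmetric.sub hB'.isSymmetric hB.isSymmetric,
      fun x => ?_⟩⟩
  · rw [reApplyInnerSelf_apply, sub_apply, inner_sub_left, one_apply_eq_self,
      RCLike.re_to_complex, Complex.sub_re, comp_apply, hform, inner_self_eq_norm_sq_to_K]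
    norm_cast
    exact sub_nonneg.2 (pow_le_pow_left₀ (norm_nonneg _) (hT1' x) 2)
  · rw [comp_apply, hTa, hT]
  · rw [reApplyInnerSelf_apply, sub_apply, inner_sub_left, RCLike.re_to_complex,
      Complex.sub_re, comp_apply, hform, ← norm_sqrt_apply_sq hB', sub_nonneg]
    have hs : ∀ x y, inner ℂ (CFC.sqrt B' x) y = inner ℂ x (CFC.sqrt B' y) :=
      (isPositive_sqrt B').isSymmetric
    -- Cauchy–Schwarz for `B'` bounds `⟪b v, x⟫ = ⟪B' (a v), x⟫`
    have hbound : ∀ e : E, ‖inner ℂ e (adjoint T x)‖ ≤ ‖e‖ * ‖CFC.sqrt B' x‖ := fun e => by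
      induction e using hj.induction_on with
      | hp => exact isClosed_le (by fun_prop) (by fun_prop)
      | ih v =>
        have hv : ‖CFC.sqrt B' (a v)‖ = ‖j v‖ := by
          rw [← sq_eq_sq₀ (norm_nonneg _) (norm_nonneg _), norm_sqrt_apply_sq hB', hB'a, hjnorm,
            hnorm]
        rw [adjoint_inner_right, hT, ← hB'a, ← hB'.sqrt_sqrt_apply, hs, ← hv]
        exact norm_inner_le_norm _ _
    have := hbound (adjoint T x)
    rw [inner_self_eq_norm_sq_to_K, norm_pow, RCLike.norm_ofReal, abs_norm] at this
    nlinarith [sq_nonneg (‖adjoint T x‖ - ‖CFC.sqrt B' x‖)]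

/-! ### The Friedrichs and Krein–von Neumann extensions -/

/-- A positive contraction `B` extending `(1 + S)⁻¹` is injective, because its range contains the
dense domain of `S`; so it is the resolvent of an extension of `S`. -/
theorem exists_resolvent_isNonnegSelfAdjointExtension {S : H →ₗ.[ℂ] H}
    (hS : Dense (S.domain : Set H)) {B : H →L[ℂ] H} (hB : B.IsPositive)
    (hB1 : (1 - B).IsPositive) (hBS : ∀ f : S.domain, B (f + S f) = f) :
    ∃ A, IsResolvent B A ∧ IsNonnegSelfAdjointExtension S A := by
  have hinj : Function.Injective B := by
    rw [injective_iff_map_eq_zero]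
    intro x hx
    refine hS.eq_zero_of_inner_left ℂ fun f hf => ?_
    have hsB : ∀ x y, inner ℂ (B x) y = inner ℂ x (B y) := hB.isSymmetric
    have hf' : B (f + S ⟨f, hf⟩) = f := hBS ⟨f, hf⟩
    rw [← hf', ← hsB, hx, inner_zero_left]
  obtain ⟨A, hA, hAB⟩ := exists_isResolvent_of_injective hB hB1 hinj
  exact ⟨A, hAB, hAB.le_iff.2 hBS, hA⟩

/-- The resolvent of the Friedrichs extension is the smallest positive extension of the partially
defined operator `(1 + S)⁻¹`. -/
theorem exists_isFriedrichsExtension {S : H →ₗ.[ℂ] H} (hS : IsSymmetricOp S) (hS0 : IsNonnegOp S) :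
    ∃ A, IsFriedrichsExtension S A := by
  obtain ⟨B, hB, hB1, hBS, hmin⟩ := exists_least_positive_extension
    (S.domain.subtype + S.toFun) S.domain.subtype
    (fun f g => by
      have := hS.2 f g
      simp only [LinearMap.add_apply, Submodule.subtype_apply, LinearPMap.toFun_eq_coe,
        inner_add_left, inner_add_right]
      rw [this])
    (fun f => by
      have := hS0 f
      simp only [LinearMap.add_apply, Submodule.subtype_apply, LinearPMap.toFun_eq_coe,
        inner_add_right, Complex.add_re]
      rw [inner_self_eq_norm_sq_to_K]
      norm_cast
      exact le_add_of_nonneg_right this)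
  obtain ⟨A, hAB, hA⟩ := exists_resolvent_isNonnegSelfAdjointExtension hS.1 hB hB1 hBS
  refine ⟨A, hA, fun A' hA' => ?_⟩
  obtain ⟨B', hB'⟩ := hA'.2.exists_isResolvent
  exact hB'.opLE hAB (hmin B' hB'.isPositive (hB'.le_iff.1 hA'.1))

/-- The resolvent of the Krein–von Neumann extension is `1 - B`, where `B` is the smallest positive
extension of the partially defined operator `S (1 + S)⁻¹ = 1 - (1 + S)⁻¹`. -/
theorem exists_isKreinVonNeumannExtension {S : H →ₗ.[ℂ] H} (hS : IsSymmetricOp S)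
    (hS0 : IsNonnegOp S) : ∃ A, IsKreinVonNeumannExtension S A := by
  obtain ⟨B, hB, hB1, hBS, hmin⟩ := exists_least_positive_extension
    (S.domain.subtype + S.toFun) S.toFun
    (fun f g => by
      have := hS.2 f g
      simp only [LinearMap.add_apply, Submodule.subtype_apply, LinearPMap.toFun_eq_coe,
        inner_add_left, inner_add_right]
      rw [this])
    (fun f => by
      have := hS0 f
      simp only [LinearMap.add_apply, Submodule.subtype_apply, LinearPMap.toFun_eq_coe,
        inner_add_right, Complex.add_re]
      rw [inner_self_eq_norm_sq_to_K, hS.2 f f]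
      norm_cast
      exact le_add_of_nonneg_left this)
  have hBS' : ∀ f : S.domain, B (f + S f) = S f := hBS
  obtain ⟨A, hAB, hA⟩ := exists_resolvent_isNonnegSelfAdjointExtension hS.1 hB1
    (by rwa [sub_sub_cancel]) (fun f => by
      rw [sub_apply, one_apply_eq_self, hBS', add_sub_cancel_right])
  refine ⟨A, hA, fun A' hA' => ?_⟩
  obtain ⟨B', hB'⟩ := hA'.2.exists_isResolvent
  refine hAB.opLE hB' (le_sub_comm.1 (hmin (1 - B') hB'.one_sub_isPositive fun f => ?_))
  change (1 - B') (f + S f) = S f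
  rw [sub_apply, one_apply_eq_self, hB'.le_iff.1 hA'.1, add_sub_cancel_left]

/-! ### Invariance under `K` -/

theorem IsNonnegSelfAdjointExtension.conjOp {S A : H →ₗ.[ℂ] H}
    (h : IsNonnegSelfAdjointExtension S A) {K : H →L[ℂ] H} (hK : IsUnit K)
    (hS : IsKInvariant K S) : IsNonnegSelfAdjointExtension S (conjOp K A) :=
  ⟨hS.symm.le.trans (conjOp_mono K h.1), h.2.conjOp hK⟩

theorem IsKInvariant.of_mul_eq_one {K L : H →L[ℂ] H} (h : K * L = 1) {S : H →ₗ.[ℂ] H}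
    (hS : IsKInvariant K S) : IsKInvariant L S := by
  have := conjOp_conjOp K L S
  rwa [hS, h, conjOp_one] at this

/-- If `A` is the largest extension, then both `K* A K ≤ A` and `K⁻* A K⁻¹ ≤ A`; conjugating the
second inequality by `K` gives `A ≤ K* A K`. -/
theorem IsFriedrichsExtension.isKInvariant {S A : H →ₗ.[ℂ] H} (h : IsFriedrichsExtension S A)
    {K : H →L[ℂ] H} (hK : IsUnit K) (hS : IsKInvariant K S) : IsKInvariant K A := by
  obtain ⟨L, hKL, hLK⟩ := isUnit_iff_exists.1 hK
  have hL : IsUnit L := isUnit_iff_exists.2 ⟨K, hLK, hKL⟩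
  have hA' := h.1.conjOp hK hS
  have hA'' := h.1.conjOp hL (hS.of_mul_eq_one hKL)
  have hback : conjOp K (conjOp L A) = A := by rw [conjOp_conjOp, hLK, conjOp_one]
  obtain ⟨B, hB⟩ := h.1.2.exists_isResolvent
  obtain ⟨B', hB'⟩ := hA'.2.exists_isResolvent
  obtain rfl : B = B' := le_antisymm ((h.2 _ hA').resolvent_le hB' hB)
    ((h.2 _ hA'').resolvent_conjOp_le (by rwa [hback]) hB')
  exact hB'.unique hB

/-- The mirror image of `IsFriedrichsExtension.isKInvariant` for the smallest extension. -/
theorem IsKreinVonNeumannExtension.isKInvariant {S A : H →ₗ.[ℂ] H}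
    (h : IsKreinVonNeumannExtension S A) {K : H →L[ℂ] H} (hK : IsUnit K)
    (hS : IsKInvariant K S) : IsKInvariant K A := by
  obtain ⟨L, hKL, hLK⟩ := isUnit_iff_exists.1 hK
  have hL : IsUnit L := isUnit_iff_exists.2 ⟨K, hLK, hKL⟩
  have hA' := h.1.conjOp hK hS
  have hA'' := h.1.conjOp hL (hS.of_mul_eq_one hKL)
  have hback : conjOp K (conjOp L A) = A := by rw [conjOp_conjOp, hLK, conjOp_one]
  obtain ⟨B, hB⟩ := h.1.2.exists_isResolvent
  obtain ⟨B', hB'⟩ := hA'.2.exists_isResolvent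
  obtain rfl : B = B' := le_antisymm
    ((h.2 _ hA'').resolvent_conjOp_le hB' (by rwa [hback])) ((h.2 _ hA').resolvent_le hB hB')
  exact hB'.unique hB

end KInv

theorem mainTheorem1 {H : Type*} [NormedAddCommGroup H] [InnerProductSpace ℂ H] [CompleteSpace H]
    (K : H →L[ℂ] H) (hK : IsUnit K)
    (S : H →ₗ.[ℂ] H) (hS : KInv.IsSymmetricOp S) (hS0 : KInv.IsNonnegOp S)
    (hSK : KInv.IsKInvariant K S) :
    (∃! A : H →ₗ.[ℂ] H, KInv.IsFriedrichsExtension S A) ∧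
    (∃! A : H →ₗ.[ℂ] H, KInv.IsKreinVonNeumannExtension S A) ∧
    (∀ S_F : H →ₗ.[ℂ] H, KInv.IsFriedrichsExtension S S_F → KInv.IsKInvariant K S_F) ∧
    (∀ S_K : H →ₗ.[ℂ] H, KInv.IsKreinVonNeumannExtension S S_K → KInv.IsKInvariant K S_K) := by
  obtain ⟨F, hF⟩ := KInv.exists_isFriedrichsExtension hS hS0
  obtain ⟨N, hN⟩ := KInv.exists_isKreinVonNeumannExtension hS hS0
  exact ⟨⟨F, hF, fun A hA => (hF.2 A hA.1).antisymm (hA.2 F hF.1) hA.1.2 hF.1.2⟩,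
    ⟨N, hN, fun A hA => (hA.2 N hN.1).antisymm (hN.2 A hA.1) hA.1.2 hN.1.2⟩,
    fun _ hA => hA.isKInvariant hK hSK, fun _ hA => hA.isKInvariant hK hSK⟩
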